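/- Let $\mathcal{RL}_\infty^{m\times m}$ denote the set of $m\times m$ proper real-rational transfer function matrices without poles on the imaginary axis $j\mathbb R$. For $G\in\mathcal{RL}_\infty^{m\times m}$ the frequency response $G(j\omega)$ is considered for all $\omega\in[-\infty,\infty]$, with $G(\pm j\infty)=G(\infty)=\lim_{|s|\to\infty}G(s)$. Poles of a proper transfer matrix are counted with their McMillan multiplicity: the multiplicity of $s\in\mathbb C$ as a pole of $G$ is its multiplicity as a root of the pole polynomial of $G$ (the least common denominator of all square minors of $G$), i.e. the largest order of $s$ as a pole of a square minor of $G$. A transfer matrix $G$ is called $p$-dominant if $G\in\mathcal{RL}_\infty$ and $G$ has exactly $p$ poles in the open right half-plane. The positive feedback system $P\#C$ is called well-posed if $I-P(\infty)C(\infty)$ has full rank; it is called $p$-dominant if it is well-posed and the transfer matrix $$\begin{bmatrix} I & -C\\ -P & I\end{bmatrix}^{-1}$$ belongs to $\mathcal{RL}_\infty^{2m\times 2m}$ and is $p$-dominant. It has no unstable pole-zero cancellation if the number of poles of $PC$ in the closed right half-plane equals the sum of the numbers of poles of $P$ and of $C$ there. For $A\in\mathbb C^{m\times m}$, let $\bar\sigma(A)$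 be its largest singular value and let its scaled graph be $$\mathrm{SG}(A)=\left\{\frac{\|Ax\|_2}{\|x\|_2}\,e^{\pm j\theta(x,Ax)} : x\in\mathbb C^m,\ x\neq0,\ Ax\neq 0\right\},\qquad \theta(x,y)=\arccos\frac{\mathrm{Re}(x^*y)}{\|x\|_2\|y\|_2}\in[0,\pi],$$ and let $\psi(A)=\sup_{z\in \mathrm{SG}(A)}|\angle z|\in[0,\pi]$, with $\angle z\in(-\pi,\pi]$ (and $\psi(A)=0$ if $A=0$). **Corollary.** Let $P\in\mathcal{RL}_\infty^{m\times m}$ be $p_1$-dominant and $C\in\mathcal{RL}_\infty^{m\times m}$ be $p_2$-dominant, and suppose that there is no unstable pole-zero cancellation in $P\#C$. Then $P\#C$ is $(p_1+p_2)$-dominant if for every $\omega\in[-\infty,\infty]$ at least one of the following conditions holds (which one may depend on $\omega$): (i) $\bar\sigma(P(j\omega))\,\bar\sigma(C(j\omega))<1$; (ii) $\psi(P(j\omega))+\psi(-C(j\omega))<\pi$; (iii) $P(j\omega)+P(j\omega)^*\ge 0$ (positive semidefinite) and $C(j\omega)+C(j\omega)^*<0$ (negative definite). -/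

import Mathlib

open scoped ComplexOrder

noncomputable section

namespace Dominance

/-! ### Real-rational transfer function matrices

A transfer function matrix is a matrix over the field `RatFunc ℝ` of real rational functions in the
Laplace variable `s`. For a rational function `g`, `g.num` and `g.denom` are coprime and `g.denom`
is monic, so the poles of `g` are the complex roots of `g.denom`. -/

section Transfer

variable {n : Type*} [Fintype n]

/-- `g` is proper: the degree of the numerator does not exceed that of the denominator. -/
def IsProper (g : RatFunc ℝ) : Prop :=
  g.num.natDegree ≤ g.denom.natDegree

/-- The value `g(∞) = lim_{|s| → ∞} g(s)` of a proper rational function. -/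
def valueAtInfty (g : RatFunc ℝ) : ℝ :=
  g.num.coeff g.denom.natDegree / g.denom.leadingCoeff

/-- The order of `s` as a pole of the scalar rational function `g` (`0` if `s` is not a pole). -/
def poleOrder (g : RatFunc ℝ) (s : ℂ) : ℕ :=
  (g.denom.map (algebraMap ℝ ℂ)).rootMultiplicity s

/-- `RLinf G`: every entry of `G` is proper, and no entry has a pole on the imaginary axis. -/
def RLinf (G : Matrix n n (RatFunc ℝ)) : Prop :=
  (∀ i j, IsProper (G i j)) ∧
    ∀ i j, ∀ ω : ℝ, ¬ ((G i j).denom.map (algebraMap ℝ ℂ)).IsRoot (ω * Complex.I)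

/-- The index set of the square minors of an `n × n` matrix: the size `k`, the `k` distinct rows
and the `k` distinct columns (the order of the rows and columns only affects the sign). -/
abbrev MinorIndex (n : Type*) [Fintype n] : Type _ :=
  Σ k : Fin (Fintype.card n + 1), (Fin k ↪ n) × (Fin k ↪ n)

/-- The minor of `G` with index `μ`. -/
def minor (G : Matrix n n (RatFunc ℝ)) (μ : MinorIndex n) : RatFunc ℝ :=
  (G.submatrix μ.2.1 μ.2.2).det

/-- The multiplicity of `s` as a pole of the transfer matrix `G` (in the sense of McMillan): the
largest order of `s` as a pole of a square minor of `G`. This is the multiplicity of `s` as a root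
of the pole polynomial of `G`, the monic least common denominator of all minors of `G`. -/
def poleMult (G : Matrix n n (RatFunc ℝ)) (s : ℂ) : ℕ :=
  Finset.univ.sup fun μ : MinorIndex n => poleOrder (minor G μ) s

/-- A transfer matrix has finitely many poles. -/
theorem finite_support_poleMult (G : Matrix n n (RatFunc ℝ)) :
    (Function.support (poleMult G)).Finite := by
  refine Set.Finite.subset (s := ⋃ μ : MinorIndex n,
    {s : ℂ | ((minor G μ).denom.map (algebraMap ℝ ℂ)).IsRoot s}) ?_ ?_
  · refine Set.finite_iUnion fun μ => ?_
    exact Polynomial.finite_setOfPred_isRoot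
      ((Polynomial.map_ne_zero_iff (algebraMap ℝ ℂ).injective).2 (RatFunc.denom_ne_zero _))
  · intro s hs
    by_contra h
    simp only [Set.mem_iUnion, not_exists, Set.mem_ofPred_eq] at h
    refine hs ?_
    have : ∀ μ ∈ (Finset.univ : Finset (MinorIndex n)), poleOrder (minor G μ) s ≤ 0 :=
      fun μ _ => (Polynomial.rootMultiplicity_eq_zero (h μ)).le
    exact Nat.le_zero.1 (Finset.sup_le this)

/-- The number of poles of `G` in `S ⊆ ℂ`, counted with multiplicity. For `S = ℂ` this is the
McMillan degree of `G`. (The sum has finitely many nonzero terms.) -/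
def numPoles (G : Matrix n n (RatFunc ℝ)) (S : Set ℂ) : ℕ :=
  ∑ᶠ s ∈ S, poleMult G s

/-- The open right half-plane. -/
def openRHP : Set ℂ := {s | 0 < s.re}

/-- The closed right half-plane. -/
def closedRHP : Set ℂ := {s | 0 ≤ s.re}

/-- `G` is `p`-dominant: `G` belongs to `RL∞` and has exactly `p` poles in the open right
half-plane. -/
def IsDominant (p : ℕ) (G : Matrix n n (RatFunc ℝ)) : Prop :=
  RLinf G ∧ numPoles G openRHP = p

/-- The frequency response `G(jω)`, `ω ∈ [-∞, ∞]`, with `G(j(±∞)) = G(∞)`. -/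
def freqResp (G : Matrix n n (RatFunc ℝ)) (ω : EReal) : Matrix n n ℂ :=
  if ω = ⊤ ∨ ω = ⊥ then G.map fun g => (valueAtInfty g : ℂ)
  else G.map fun g => g.eval (algebraMap ℝ ℂ) (ω.toReal * Complex.I)

variable [DecidableEq n]

/-- The positive feedback system `P # C` is well-posed: `I - P(∞) C(∞)` has full rank. -/
def WellPosed (P C : Matrix n n (RatFunc ℝ)) : Prop :=
  (1 - P.map valueAtInfty * C.map valueAtInfty).rank = Fintype.card n

/-- The transfer matrix of `P # C` from the external signals `(w₁, w₂)` to the internal signals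
`(u₁, u₂)`. -/
def closedLoop (P C : Matrix n n (RatFunc ℝ)) : Matrix (n ⊕ n) (n ⊕ n) (RatFunc ℝ) :=
  (Matrix.fromBlocks 1 (-C) (-P) 1)⁻¹

/-- The feedback system `P # C` is `p`-dominant. -/
def FeedbackDominant (p : ℕ) (P C : Matrix n n (RatFunc ℝ)) : Prop :=
  WellPosed P C ∧ IsDominant p (closedLoop P C)

/-- `P # C` has no unstable pole-zero cancellation. -/
def NoUnstableCancellation (P C : Matrix n n (RatFunc ℝ)) : Prop :=
  numPoles (P * C) closedRHP = numPoles P closedRHP + numPoles C closedRHP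

end Transfer

/-! ### Gain and phase of complex matrices -/

section Matrices

variable {n : Type*} [Fintype n] [DecidableEq n]

/-- The largest singular value of `A` (singular values are indexed from `0` in decreasing order). -/
def maxSingularValue (A : Matrix n n ℂ) : ℝ :=
  (Matrix.toEuclideanLin A).singularValues 0

/-- The gain from `x ≠ 0` to `y`. -/
def gain (x y : EuclideanSpace ℂ n) : ℝ :=
  ‖y‖ / ‖x‖

/-- The phase from `x ≠ 0` to `y ≠ 0`, an angle in `[0, π]`. -/
def phase (x y : EuclideanSpace ℂ n) : ℝ :=
  Real.arccos ((inner ℂ x y).re / (‖x‖ * ‖y‖))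

/-- The scaled graph of `A`: all `γ(x, Ax) exp(± j θ(x, Ax))` with `x ≠ 0` and `Ax ≠ 0`. -/
def scaledGraph (A : Matrix n n ℂ) : Set ℂ :=
  {z | ∃ x : EuclideanSpace ℂ n, x ≠ 0 ∧ Matrix.toEuclideanLin A x ≠ 0 ∧
    (z = gain x (Matrix.toEuclideanLin A x) *
        Complex.exp (phase x (Matrix.toEuclideanLin A x) * Complex.I) ∨
      z = gain x (Matrix.toEuclideanLin A x) *
        Complex.exp (-(phase x (Matrix.toEuclideanLin A x) * Complex.I)))}

/-- The maximum phase `ψ(A)`: the supremum of `|∠z|` over the scaled graph of `A`, a number in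
`[0, π]` (it is `0` if `A = 0`, when the scaled graph is empty). -/
def maxPhase (A : Matrix n n ℂ) : ℝ :=
  sSup ((fun z : ℂ => |z.arg|) '' scaledGraph A)

end Matrices

end Dominance

end

/-!
The proof compares the poles of the closed loop with those of `P` and `C` at each point of `ℂ`, and
then counts the zeros of the return difference `det (I - P C)` by a homotopy.

*Local pole balance.* Fix `s : ℂ` and let `v` be the corresponding place of `ℝ(s)`, normalised so
that poles have large values (`placeAt`). The McMillan multiplicity of `s` as a pole of `G` is the
logarithm of the largest value of a minor of `G` (`exp_poleMult`). Minors of all sizes of `G` are,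
up to sign, the maximal minors of the tall matrix `[I; G]`, and the largest value of a maximal minor
is easy to control (`maxMinor`): it does not increase under left multiplication by a matrix that is
integral at `v`, it is multiplied by `v (det T)` under right multiplication by `T`, and it is
multiplicative on block diagonal matrices. Since `[I; M⁻¹] M = [M; I]`, inverting `M` changes the
pole multiplicity by the order of `det M`; adding a constant matrix does not change it. With
`M = [I, -C; -P, I]`, whose determinant is `det (I - P C)`, this gives
`poleMult (closedLoop P C) s = poleMult P s + poleMult C s + ord_s det (I - P C)`
(`poleMult_closedLoop`). This is an identity for all four blocks of the closed loop, so pole-zero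
cancellations in the product `P C` are accounted for.

*Zeros of the return difference.* Each of the three frequency conditions excludes a nonzero solution
of `x = t P(jω) C(jω) x` for every `t ∈ [0, 1]` (`det_one_sub_smul_ne_zero`). Over the common
denominator `D` of `det (I - t P C)`, the numerator is a polynomial `N t` that depends continuously
on `t`; its degree is constant because of the condition at `ω = ∞`, and it has no roots on the
imaginary axis. Hence the number of its roots in the right half-plane does not depend on `t`
(`rhpRootCount_eq_of_homotopy`, a compactness argument on tuples of roots). As `N 0 = D`, the return
difference has as many zeros as poles in the open right half-plane, and summing the local balance
there gives `p₁ + p₂`.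

Properness of the closed loop and the absence of poles on the axis follow from Cramer's rule at the
place at infinity and at the places `jω`, where `det (I - P C)` is a unit.
-/

noncomputable section

namespace Dominance

/-! ### Maximal minors and valuations -/

section MaximalMinors

open scoped WithZero

variable {K : Type*} [Field K] (v : Valuation K ℤᵐ⁰)
variable {ι κ n n' : Type*} [Fintype ι] [Fintype κ] [Fintype n] [Fintype n']
  [DecidableEq n] [DecidableEq n']

theorem valuation_det_le_one {A : Matrix n n K} (hA : ∀ i j, v (A i j) ≤ 1) : v A.det ≤ 1 := by
  rw [Matrix.det_apply]
  refine v.map_sum_le fun σ _ => ?_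
  have h : v (∏ i, A (σ i) i) ≤ 1 := by
    rw [map_prod]
    exact Finset.prod_le_one' fun i _ => hA _ _
  rcases Int.units_eq_one_or (Equiv.Perm.sign σ) with h1 | h1 <;> simpa [h1, Units.smul_def] using h

/-- The largest value `v (det W')`, where `W'` runs over the square matrices formed by rows of `W`
(a choice with a repeated row contributes `v 0 = 0`). -/
def maxMinor (W : Matrix ι n K) : ℤᵐ⁰ :=
  Finset.univ.sup fun f : n → ι => v (W.submatrix f id).det

theorem le_maxMinor (W : Matrix ι n K) (f : n → ι) : v (W.submatrix f id).det ≤ maxMinor v W :=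
  Finset.le_sup (f := fun f : n → ι => v (W.submatrix f id).det) (Finset.mem_univ f)

theorem maxMinor_le {W : Matrix ι n K} {a : ℤᵐ⁰} (h : ∀ f : n → ι, v (W.submatrix f id).det ≤ a) :
    maxMinor v W ≤ a :=
  Finset.sup_le fun f _ => h f

theorem exists_eq_maxMinor {W : Matrix ι n K} (h : maxMinor v W ≠ 0) :
    ∃ f : n → ι, v (W.submatrix f id).det = maxMinor v W := by
  have : Nonempty (n → ι) := by
    by_contra hne
    rw [not_nonempty_iff] at hne
    exact h (by simp [maxMinor])
  obtain ⟨f, -, hf⟩ := Finset.exists_mem_eq_sup Finset.univ Finset.univ_nonempty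
    (fun f : n → ι => v (W.submatrix f id).det)
  exact ⟨f, hf.symm⟩

theorem maxMinor_le_one {W : Matrix ι n K} (hW : ∀ i j, v (W i j) ≤ 1) : maxMinor v W ≤ 1 :=
  maxMinor_le v fun _ => valuation_det_le_one v fun _ _ => hW _ _

/-- Half of the Cauchy–Binet formula: a determinant formed by rows of `U * W` is a combination of
determinants formed by rows of `W`. -/
theorem det_submatrix_mul {l : Type*} (U : Matrix l ι K) (W : Matrix ι n K) (f : n → l) :
    ((U * W).submatrix f id).det =
      ∑ g : n → ι, (∏ i, U (f i) (g i)) * (W.submatrix g id).det := by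
  have h : (U * W).submatrix f id = fun i => ∑ k, U (f i) k • W k := by
    ext i j
    simp [Matrix.mul_apply, Finset.sum_apply]
  change Matrix.detRowAlternating.toMultilinearMap ((U * W).submatrix f id) = _
  rw [h, MultilinearMap.map_sum]
  refine Finset.sum_congr rfl fun g _ => ?_
  rw [MultilinearMap.map_smul_univ]
  rfl

theorem maxMinor_mul_left_le {U : Matrix κ ι K} (hU : ∀ i j, v (U i j) ≤ 1) (W : Matrix ι n K) :
    maxMinor v (U * W) ≤ maxMinor v W := by
  refine maxMinor_le v fun f => ?_
  rw [det_submatrix_mul]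
  refine v.map_sum_le fun g _ => ?_
  rw [map_mul, map_prod]
  exact (mul_le_of_le_one_left' (Finset.prod_le_one' fun i _ => hU _ _)).trans (le_maxMinor v W g)

theorem maxMinor_mul_right (W : Matrix ι n K) (T : Matrix n n K) :
    maxMinor v (W * T) = maxMinor v W * v T.det := by
  have key : ∀ f : n → ι, v ((W * T).submatrix f id).det = v (W.submatrix f id).det * v T.det := by
    intro f
    rw [← map_mul, ← Matrix.det_mul]
    rfl
  apply le_antisymm
  · refine maxMinor_le v fun f => ?_
    rw [key]
    exact mul_le_mul_left (le_maxMinor v W f) _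
  · by_cases h : maxMinor v W = 0
    · simp [h]
    · obtain ⟨f, hf⟩ := exists_eq_maxMinor v h
      rw [← hf, ← key]
      exact le_maxMinor v _ f

theorem maxMinor_submatrix_le (W : Matrix ι n K) (e : κ → ι) :
    maxMinor v (W.submatrix e id) ≤ maxMinor v W :=
  maxMinor_le v fun f => le_maxMinor v W (e ∘ f)

theorem maxMinor_submatrix_equiv (W : Matrix ι n K) (e : κ ≃ ι) :
    maxMinor v (W.submatrix e id) = maxMinor v W := by
  refine le_antisymm (maxMinor_submatrix_le v W e) ?_
  simpa using maxMinor_submatrix_le v (W.submatrix e id) e.symm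

/-- Dividing by the rows of a dominant minor makes a matrix integral, by Cramer's rule. -/
theorem exists_integral_factor {W : Matrix ι n K} (h : maxMinor v W ≠ 0) :
    ∃ S : Matrix n n K, IsUnit S.det ∧ v S.det = maxMinor v W ∧
      ∀ i j, v ((W * S⁻¹) i j) ≤ 1 := by
  obtain ⟨f, hf⟩ := exists_eq_maxMinor v h
  have hdet : (W.submatrix f id).det ≠ 0 := by
    intro h0
    rw [h0, map_zero] at hf
    exact h hf.symm
  refine ⟨W.submatrix f id, hdet.isUnit, hf, fun i j => ?_⟩
  have h1 : (W * (W.submatrix f id)⁻¹) i j =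
      ((W.submatrix f id).det)⁻¹ * (W.submatrix (Function.update f j i) id).det := by
    have h2 : (W.submatrix (Function.update f j i) id) = (W.submatrix f id).updateRow j (W i) := by
      ext a b
      by_cases hab : a = j
      · subst hab; simp
      · simp [hab]
    rw [h2, ← Matrix.cramer_transpose_apply, Matrix.cramer_eq_adjugate_mulVec,
      ← Matrix.adjugate_transpose, Matrix.inv_def, Matrix.mul_apply, Matrix.mulVec, dotProduct,
      Finset.mul_sum, Ring.inverse_eq_inv']
    refine Finset.sum_congr rfl fun k _ => ?_
    simp only [Matrix.smul_apply, Matrix.transpose_apply, smul_eq_mul]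
    ring
  rw [h1, map_mul, map_inv₀, hf]
  calc _ ≤ (maxMinor v W)⁻¹ * maxMinor v W := by gcongr; exact le_maxMinor v W _
    _ = 1 := inv_mul_cancel₀ h

/-- For the upper bound, both blocks are made integral by right factors, which bounds all the
mixed minors at once. -/
theorem maxMinor_fromBlocks_diagonal {W₁ : Matrix ι n K} {W₂ : Matrix κ n' K}
    (h₁ : maxMinor v W₁ ≠ 0) (h₂ : maxMinor v W₂ ≠ 0) :
    maxMinor v (Matrix.fromBlocks W₁ 0 0 W₂) = maxMinor v W₁ * maxMinor v W₂ := by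
  apply le_antisymm
  · obtain ⟨S₁, hu₁, hS₁, hi₁⟩ := exists_integral_factor v h₁
    obtain ⟨S₂, hu₂, hS₂, hi₂⟩ := exists_integral_factor v h₂
    have hW : Matrix.fromBlocks W₁ 0 0 W₂ =
        Matrix.fromBlocks (W₁ * S₁⁻¹) 0 0 (W₂ * S₂⁻¹) * Matrix.fromBlocks S₁ 0 0 S₂ := by
      simp [Matrix.fromBlocks_multiply, Matrix.mul_assoc, Matrix.nonsing_inv_mul _ hu₁,
        Matrix.nonsing_inv_mul _ hu₂]
    rw [hW, maxMinor_mul_right, Matrix.det_fromBlocks_zero₂₁, map_mul, hS₁, hS₂]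
    refine mul_le_of_le_one_left' (maxMinor_le_one v ?_)
    rintro (i | i) (j | j)
    · exact hi₁ i j
    · simp
    · simp
    · exact hi₂ i j
  · obtain ⟨f, hf⟩ := exists_eq_maxMinor v h₁
    obtain ⟨g, hg⟩ := exists_eq_maxMinor v h₂
    refine le_trans (le_of_eq ?_) (le_maxMinor v _ (Sum.map f g))
    have : (Matrix.fromBlocks W₁ 0 0 W₂).submatrix (Sum.map f g) id =
        Matrix.fromBlocks (W₁.submatrix f id) 0 0 (W₂.submatrix g id) := by
      ext (i | i) (j | j) <;> rfl
    rw [this, Matrix.det_fromBlocks_zero₂₁, map_mul, hf, hg]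

/-- The pole size of a square matrix `G` at the place `v`: the largest value of a minor of `G` of
any size. A minor of `G` is, up to sign, a maximal minor of the matrix `G` below an identity
matrix. -/
def poleVal (G : Matrix n n K) : ℤᵐ⁰ :=
  maxMinor v (Matrix.fromRows (1 : Matrix n n K) G)

theorem one_le_poleVal (G : Matrix n n K) : 1 ≤ poleVal v G := by
  have h := le_maxMinor v (Matrix.fromRows (1 : Matrix n n K) G) Sum.inl
  have h1 : (Matrix.fromRows (1 : Matrix n n K) G).submatrix Sum.inl id = 1 := rfl
  rwa [h1, Matrix.det_one, map_one] at h

theorem poleVal_ne_zero (G : Matrix n n K) : poleVal v G ≠ 0 :=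
  (lt_of_lt_of_le zero_lt_one (one_le_poleVal v G)).ne'

theorem valuation_one_apply_le {l : Type*} [DecidableEq l] (i j : l) :
    v ((1 : Matrix l l K) i j) ≤ 1 := by
  by_cases h : i = j <;> simp [Matrix.one_apply, h]

theorem poleVal_add_le (G : Matrix n n K) {B : Matrix n n K} (hB : ∀ i j, v (B i j) ≤ 1) :
    poleVal v (G + B) ≤ poleVal v G := by
  have h : Matrix.fromRows (1 : Matrix n n K) (G + B) =
        Matrix.fromBlocks (1 : Matrix n n K) 0 B (1 : Matrix n n K) *
          Matrix.fromRows (1 : Matrix n n K) G := by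
    rw [Matrix.fromBlocks_mul_fromRows]
    simp [add_comm]
  rw [poleVal, h]
  refine maxMinor_mul_left_le v ?_ _
  rintro (i | i) (j | j)
  · exact valuation_one_apply_le v i j
  · simp
  · exact hB i j
  · exact valuation_one_apply_le v i j

/-- The pole size is unchanged by an integral summand `B`: `[I; G + B]` is the product of the
unimodular matrix `[I, 0; B, I]` and `[I; G]`. -/
theorem poleVal_add (G : Matrix n n K) {B : Matrix n n K} (hB : ∀ i j, v (B i j) ≤ 1) :
    poleVal v (G + B) = poleVal v G := by
  refine le_antisymm (poleVal_add_le v G hB) ?_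
  simpa using poleVal_add_le v (G + B) (B := -B) fun i j => by simpa using hB i j

theorem poleVal_mul_left_le {U : Matrix n n K} (hU : ∀ i j, v (U i j) ≤ 1) (G : Matrix n n K) :
    poleVal v (U * G) ≤ poleVal v G := by
  have h : Matrix.fromRows (1 : Matrix n n K) (U * G) =
        Matrix.fromBlocks (1 : Matrix n n K) 0 0 U * Matrix.fromRows (1 : Matrix n n K) G := by
    rw [Matrix.fromBlocks_mul_fromRows]
    simp
  rw [poleVal, h]
  refine maxMinor_mul_left_le v ?_ _
  rintro (i | i) (j | j)
  · exact valuation_one_apply_le v i j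
  · simp
  · simp
  · exact hU i j

theorem poleVal_fromBlocks_diagonal (P : Matrix n n K) (C : Matrix n' n' K) :
    poleVal v (Matrix.fromBlocks P 0 0 C) = poleVal v P * poleVal v C := by
  have h : Matrix.fromRows 1 (Matrix.fromBlocks P 0 0 C) =
      (Matrix.fromBlocks (Matrix.fromRows 1 P) 0 0 (Matrix.fromRows 1 C)).submatrix
        (Equiv.sumSumSumComm n n' n n') id := by
    ext ((i | i) | (i | i)) (j | j) <;> simp [Matrix.one_apply]
  rw [poleVal, h, maxMinor_submatrix_equiv,
    maxMinor_fromBlocks_diagonal v (poleVal_ne_zero v P) (poleVal_ne_zero v C)]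
  rfl

/-- The matrices `[I; M⁻¹]` and `[M; I]` differ by the right factor `M`, so inversion changes the
pole size by `v (det M)`. -/
theorem poleVal_inv_mul {M : Matrix n n K} (hM : IsUnit M.det) :
    poleVal v M⁻¹ * v M.det = poleVal v M := by
  rw [poleVal, ← maxMinor_mul_right, Matrix.fromRows_mul, Matrix.one_mul,
    Matrix.nonsing_inv_mul _ hM, poleVal, ← maxMinor_submatrix_equiv v _ (Equiv.sumComm n n)]
  congr 1
  ext (i | i) j <;> rfl

theorem valuation_inv_apply_le_one {M : Matrix n n K} (hM : ∀ i j, v (M i j) ≤ 1)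
    (hdet : v M.det = 1) (i j : n) : v (M⁻¹ i j) ≤ 1 := by
  rw [Matrix.inv_def, Matrix.smul_apply, smul_eq_mul, Ring.inverse_eq_inv', map_mul, map_inv₀,
    hdet, inv_one, one_mul, Matrix.adjugate_apply]
  refine valuation_det_le_one v fun a b => ?_
  by_cases h : a = j
  · subst h
    rw [Matrix.updateRow_self]
    by_cases hb : b = i <;> simp [hb]
  · rw [Matrix.updateRow_ne h]
    exact hM a b

/-- Pole sizes of a feedback loop: up to an integral summand and an integral invertible left
factor, `[I, -C; -P, I]` is the block diagonal matrix of `P` and `C`. -/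
theorem poleVal_loop_inv_mul (P C : Matrix n n K)
    (hdet : (Matrix.fromBlocks 1 (-C) (-P) 1).det ≠ 0) :
    poleVal v (Matrix.fromBlocks 1 (-C) (-P) 1)⁻¹ * v (Matrix.fromBlocks 1 (-C) (-P) 1).det =
      poleVal v P * poleVal v C := by
  rw [poleVal_inv_mul v hdet.isUnit]
  let J : Matrix (n ⊕ n) (n ⊕ n) K := Matrix.fromBlocks 0 (-1) (-1) 0
  have hJ : ∀ i j, v (J i j) ≤ 1 := by
    rintro (i | i) (j | j)
    · simp [J]
    · simpa [J] using valuation_one_apply_le v i j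
    · simpa [J] using valuation_one_apply_le v i j
    · simp [J]
  have hJJ : J * J = 1 := by simp [J, Matrix.fromBlocks_multiply, Matrix.fromBlocks_one]
  have h1 : Matrix.fromBlocks 1 (-C) (-P) 1 = J * Matrix.fromBlocks P 0 0 C + 1 := by
    ext (i | i) (j | j) <;> simp [J, Matrix.fromBlocks_multiply, Matrix.one_apply]
  rw [h1, poleVal_add v _ (valuation_one_apply_le v), ← poleVal_fromBlocks_diagonal]
  refine le_antisymm (poleVal_mul_left_le v hJ _) ?_
  simpa [← Matrix.mul_assoc, hJJ] using
    poleVal_mul_left_le v hJ (J * Matrix.fromBlocks P 0 0 C)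

/-- Laplace expansion along unit rows: if the rows of `A` outside `p` are rows of the identity
matrix, then `det A` is the principal minor on `p`. -/
theorem det_eq_det_of_unit_rows (A : Matrix n n K) (p : n → Prop) [DecidablePred p]
    (h : ∀ i, ¬p i → A i = (1 : Matrix n n K) i) :
    A.det = (A.submatrix (Subtype.val : {i // p i} → n) Subtype.val).det := by
  rw [Matrix.twoBlockTriangular_det A p]
  · have : A.toSquareBlockProp (fun i => ¬p i) = 1 := by
      ext ⟨i, hi⟩ ⟨j, hj⟩
      simp [Matrix.toSquareBlockProp_def, h i hi, Matrix.one_apply]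
    rw [this, Matrix.det_one, mul_one]
    rfl
  · intro i hi j hj
    rw [h i hi, Matrix.one_apply_ne]
    rintro rfl
    exact hi hj

end MaximalMinors

/-! ### Pole orders as valuations -/

section Places

open scoped WithZero

variable {n : Type*} [Fintype n] [DecidableEq n]

/-- Every minor of `G` is a maximal minor of `[I; G]`: replace the rows of `I` indexed by the
columns of the minor by the chosen rows of `G`. -/
theorem valuation_minor_le_poleVal (v : Valuation (RatFunc ℝ) ℤᵐ⁰) (G : Matrix n n (RatFunc ℝ))
    (μ : MinorIndex n) : v (minor G μ) ≤ poleVal v G := by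
  classical
  obtain ⟨k, r, c⟩ := μ
  let p : n → Prop := fun i => ∃ a, c a = i
  let e : Fin k ≃ {i // p i} := Equiv.ofInjective c c.injective
  have he : ∀ a, (e a : n) = c a := fun a => rfl
  let f : n → n ⊕ n := fun i => if h : p i then Sum.inr (r (e.symm ⟨i, h⟩)) else Sum.inl i
  have hf : ∀ a, f (c a) = Sum.inr (r a) := by
    intro a
    have h : p (c a) := ⟨a, rfl⟩
    simp only [f, dif_pos h]
    congr 2
    exact (Equiv.symm_apply_eq e).2 rfl
  refine le_trans (le_of_eq ?_) (le_maxMinor v (Matrix.fromRows 1 G) f)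
  rw [det_eq_det_of_unit_rows _ p]
  · rw [← Matrix.det_submatrix_equiv_self e, minor]
    congr 2
    ext a b
    simp [he, hf]
  · intro i hi
    ext j
    have hfi : f i = Sum.inl i := dif_neg hi
    simp [hfi]

/-- A nonzero maximal minor of `[I; G]` is, up to sign, a minor of `G`. -/
theorem exists_poleVal_eq_minor (v : Valuation (RatFunc ℝ) ℤᵐ⁰) (G : Matrix n n (RatFunc ℝ)) :
    ∃ μ : MinorIndex n, poleVal v G = v (minor G μ) := by
  classical
  obtain ⟨f, hf⟩ := exists_eq_maxMinor v (poleVal_ne_zero v G)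
  have hdet : ((Matrix.fromRows 1 G).submatrix f id).det ≠ 0 := by
    intro h0
    rw [h0, map_zero] at hf
    exact poleVal_ne_zero v G hf.symm
  have hfi : Function.Injective f := by
    intro i j hij
    by_contra hne
    exact hdet (Matrix.det_zero_of_row_eq hne (by ext k; simp [hij]))
  -- Permute the rows so that every unit row `e_b` stands at position `b`.
  obtain ⟨σ, hσ⟩ : ∃ σ : Equiv.Perm n, ∀ b, Sum.inl b ∈ Set.range f → f (σ b) = Sum.inl b := by
    obtain ⟨σ, hσ⟩ := Equiv.Perm.exists_extending_pair
      (fun b : {b : n // Sum.inl b ∈ Set.range f} => (b : n)) (fun b => b.2.choose)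
      Subtype.val_injective (fun a b hab => Subtype.ext (Sum.inl_injective (by
        rw [← a.2.choose_spec, ← b.2.choose_spec]; exact congrArg f hab)))
    exact ⟨σ, fun b hb => by rw [hσ ⟨b, hb⟩]; exact hb.choose_spec⟩
  have hleft : ∀ b b', f (σ b) = Sum.inl b' → b' = b := fun b b' h =>
    σ.injective (hfi ((hσ b' ⟨_, h⟩).trans h.symm))
  let p : n → Prop := fun b => (f (σ b)).isRight
  have hp : ∀ b : {b // p b}, ∃ r, f (σ b) = Sum.inr r := fun b => Sum.isRight_iff.1 b.2
  choose r hr using hp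
  have hri : Function.Injective r := fun a b hab =>
    Subtype.ext (σ.injective (hfi (by rw [hr a, hr b, hab])))
  let e : Fin (Fintype.card {b // p b}) ≃ {b // p b} := (Fintype.equivFin _).symm
  refine ⟨⟨⟨Fintype.card {b // p b}, Nat.lt_succ_of_le (Fintype.card_subtype_le p)⟩,
    ⟨fun a => r (e a), hri.comp e.injective⟩,
    ⟨fun a => (e a : n), Subtype.val_injective.comp e.injective⟩⟩, ?_⟩
  rw [poleVal, ← hf]
  have h1 : v (((Matrix.fromRows 1 G).submatrix f id).submatrix σ id).det =
      v ((Matrix.fromRows 1 G).submatrix f id).det := by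
    rw [Matrix.det_permute]
    rcases Int.units_eq_one_or (Equiv.Perm.sign σ) with h | h <;> simp [h]
  rw [← h1, det_eq_det_of_unit_rows _ p]
  · rw [← Matrix.det_submatrix_equiv_self e, minor]
    congr 2
    ext a b
    simp [hr (e a)]
  · intro i hi
    obtain ⟨b, hb⟩ := Sum.isLeft_iff.1 (Sum.not_isRight.1 hi)
    have := hleft i b hb
    subst this
    ext j
    simp [hb]

/-- The multiplicity of a complex number as a root of a real polynomial. -/
def rootMult (s : ℂ) (p : Polynomial ℝ) : ℕ :=
  (p.map (algebraMap ℝ ℂ)).rootMultiplicity s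

theorem map_complex_ne_zero {p : Polynomial ℝ} (hp : p ≠ 0) : p.map (algebraMap ℝ ℂ) ≠ 0 :=
  (Polynomial.map_ne_zero_iff (algebraMap ℝ ℂ).injective).2 hp

theorem rootMult_mul (s : ℂ) {p q : Polynomial ℝ} (hp : p ≠ 0) (hq : q ≠ 0) :
    rootMult s (p * q) = rootMult s p + rootMult s q := by
  rw [rootMult, Polynomial.map_mul, Polynomial.rootMultiplicity_mul
    (mul_ne_zero (map_complex_ne_zero hp) (map_complex_ne_zero hq))]
  rfl

theorem min_rootMult_le_add (s : ℂ) {p q : Polynomial ℝ} (h : p + q ≠ 0) :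
    min (rootMult s p) (rootMult s q) ≤ rootMult s (p + q) := by
  have := map_complex_ne_zero h
  rw [Polynomial.map_add] at this
  rw [rootMult, rootMult, rootMult, Polynomial.map_add]
  exact Polynomial.rootMultiplicity_add s this

open Classical in
/-- The place of `ℝ(s)` at a complex number `s`: the valuation whose value at `g ≠ 0` is `exp k`,
where `k` is the order of `s` as a pole of `g` (negative if `s` is a zero). -/
def placeAt (s : ℂ) : Valuation (RatFunc ℝ) ℤᵐ⁰ where
  toFun g := if g = 0 then 0 else WithZero.exp ((rootMult s g.denom : ℤ) - rootMult s g.num)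
  map_zero' := by simp
  map_one' := by simp [rootMult, Polynomial.rootMultiplicity_eq_zero]
  map_mul' x y := by
    by_cases hx : x = 0
    · simp [hx]
    by_cases hy : y = 0
    · simp [hy]
    have h := congrArg (rootMult s) (RatFunc.num_denom_mul x y)
    have nx := RatFunc.num_ne_zero hx
    have ny := RatFunc.num_ne_zero hy
    have dx := x.denom_ne_zero
    have dy := y.denom_ne_zero
    rw [rootMult_mul s (RatFunc.num_ne_zero (mul_ne_zero hx hy)) (mul_ne_zero dx dy),
      rootMult_mul s dx dy, rootMult_mul s (mul_ne_zero nx ny) (x * y).denom_ne_zero,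
      rootMult_mul s nx ny] at h
    rw [if_neg (mul_ne_zero hx hy), if_neg hx, if_neg hy, ← WithZero.exp_add]
    congr 1
    push_cast [← @Nat.cast_inj ℤ] at h
    linarith
  map_add_le_max' x y := by
    by_cases hx : x = 0
    · simp [hx]
    by_cases hy : y = 0
    · simp [hy]
    by_cases hxy : x + y = 0
    · simp [hxy]
    have e := RatFunc.num_denom_add x y
    have nx := RatFunc.num_ne_zero hx
    have ny := RatFunc.num_ne_zero hy
    have dx := x.denom_ne_zero
    have dy := y.denom_ne_zero
    have hs := RatFunc.num_mul_denom_add_denom_mul_num_ne_zero hxy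
    have h := congrArg (rootMult s) e
    rw [rootMult_mul s (RatFunc.num_ne_zero hxy) (mul_ne_zero dx dy),
      rootMult_mul s dx dy, rootMult_mul s hs (x + y).denom_ne_zero] at h
    have h2 := min_rootMult_le_add s hs
    rw [rootMult_mul s nx dy, rootMult_mul s dx ny] at h2
    simp only [if_neg hxy, if_neg hx, if_neg hy]
    rw [le_max_iff, WithZero.exp_le_exp, WithZero.exp_le_exp]
    omega

theorem placeAt_apply (s : ℂ) {g : RatFunc ℝ} (hg : g ≠ 0) :
    placeAt s g = WithZero.exp ((rootMult s g.denom : ℤ) - rootMult s g.num) :=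
  if_neg hg

theorem placeAt_algebraMap (s : ℂ) {p : Polynomial ℝ} (hp : p ≠ 0) :
    placeAt s (algebraMap _ _ p) = WithZero.exp (-(rootMult s p : ℤ)) := by
  rw [placeAt_apply s (by simpa using hp)]
  simp [rootMult, Polynomial.rootMultiplicity_eq_zero]

theorem rootMult_num_or_denom (s : ℂ) (g : RatFunc ℝ) :
    rootMult s g.num = 0 ∨ rootMult s g.denom = 0 := by
  by_contra! h
  have h1 := Polynomial.rootMultiplicity_pos'.1 (Nat.pos_of_ne_zero h.1)
  have h2 := Polynomial.rootMultiplicity_pos'.1 (Nat.pos_of_ne_zero h.2)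
  obtain ⟨a, b, hab⟩ := g.isCoprime_num_denom.map (Polynomial.mapRingHom (algebraMap ℝ ℂ))
  have := congrArg (Polynomial.eval s) hab
  simp only [Polynomial.coe_mapRingHom, Polynomial.eval_add, Polynomial.eval_mul,
    Polynomial.eval_one] at this
  rw [h1.2.eq_zero, h2.2.eq_zero] at this
  simp at this

theorem exp_poleOrder (s : ℂ) (g : RatFunc ℝ) :
    WithZero.exp (poleOrder g s : ℤ) = max 1 (placeAt s g) := by
  by_cases hg : g = 0
  · subst hg
    simp [poleOrder, Polynomial.rootMultiplicity_eq_zero]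
  · rw [placeAt_apply s hg, ← WithZero.exp_zero]
    have h0 : poleOrder g s = rootMult s g.denom := rfl
    rw [h0]
    rcases rootMult_num_or_denom s g with h | h
    · rw [h, max_eq_right (by rw [WithZero.exp_le_exp]; simp)]
      simp
    · rw [h, max_eq_left (by rw [WithZero.exp_le_exp]; simp)]
      simp

theorem placeAt_le_one_iff (s : ℂ) (g : RatFunc ℝ) :
    placeAt s g ≤ 1 ↔ ¬ (g.denom.map (algebraMap ℝ ℂ)).IsRoot s := by
  have h := exp_poleOrder s g
  rw [← max_eq_left_iff, ← h, ← WithZero.exp_zero, WithZero.exp_inj, poleOrder, Nat.cast_eq_zero,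
    Polynomial.rootMultiplicity_eq_zero_iff]
  have := map_complex_ne_zero g.denom_ne_zero
  tauto

/-- McMillan multiplicities are pole sizes. -/
theorem exp_poleMult (G : Matrix n n (RatFunc ℝ)) (s : ℂ) :
    WithZero.exp (poleMult G s : ℤ) = poleVal (placeAt s) G := by
  apply le_antisymm
  · have hne : (Finset.univ : Finset (MinorIndex n)).Nonempty :=
      ⟨⟨0, ⟨⟨Fin.elim0, fun a => a.elim0⟩, ⟨Fin.elim0, fun a => a.elim0⟩⟩⟩, Finset.mem_univ _⟩
    obtain ⟨μ, -, hμ⟩ := Finset.exists_mem_eq_sup _ hne (fun μ => poleOrder (minor G μ) s)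
    rw [poleMult, hμ, exp_poleOrder]
    exact max_le (one_le_poleVal _ G) (valuation_minor_le_poleVal _ G μ)
  · obtain ⟨μ, hμ⟩ := exists_poleVal_eq_minor (placeAt s) G
    rw [hμ]
    refine (le_max_right 1 _).trans ?_
    rw [← exp_poleOrder, WithZero.exp_le_exp, Nat.cast_le]
    exact Finset.le_sup (f := fun μ => poleOrder (minor G μ) s) (Finset.mem_univ μ)

end Places

/-! ### Counting roots in the right half-plane along a homotopy -/

section RootCount

open Polynomial

/-- The number of roots of a complex polynomial in the open right half-plane. -/
def rhpRootCount (p : ℂ[X]) : ℕ :=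
  p.roots.countP fun z => 0 < z.re

theorem exists_tuple_of_card_eq {α : Type*} {d : ℕ} (s : Multiset α) (h : s.card = d) :
    ∃ r : Fin d → α, Finset.univ.val.map r = s := by
  induction s using Quotient.inductionOn with
  | h l =>
    have hl : l.length = d := h
    subst hl
    exact ⟨l.get, by simp [Fin.univ_val_map]⟩

theorem rhpRootCount_prod {d : ℕ} {c : ℂ} (hc : c ≠ 0) (r : Fin d → ℂ) :
    rhpRootCount (C c * ∏ i, (X - C (r i))) =
      (Finset.univ.filter fun i => 0 < (r i).re).card := by
  have h : ∏ i, (X - C (r i)) = ((Finset.univ.val.map r).map fun a => X - C a).prod := by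
    rw [Multiset.map_map]
    rfl
  rw [rhpRootCount, roots_C_mul _ hc, h, roots_multiset_prod_X_sub_C, Multiset.countP_map]
  rfl

/-- Cauchy's bound is locally uniform: roots stay bounded as long as the coefficients vary
continuously and the leading one does not vanish. -/
theorem exists_root_bound {d : ℕ} {N : ℝ → ℂ[X]} (hcont : ∀ i, Continuous fun t => (N t).coeff i)
    (hdeg : ∀ t, (N t).natDegree ≤ d) (hlead : ∀ t ∈ Set.Icc (0 : ℝ) 1, (N t).coeff d ≠ 0) :
    ∃ R : ℝ, ∀ t ∈ Set.Icc (0 : ℝ) 1, ∀ z, (N t).IsRoot z → ‖z‖ ≤ R := by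
  have hb : ContinuousOn
      (fun t => ∑ i ∈ Finset.range d, ‖(N t).coeff i‖ / ‖(N t).coeff d‖ + 1) (Set.Icc 0 1) := by
    refine ContinuousOn.add (continuousOn_finsetSum _ fun i _ => ?_) continuousOn_const
    exact ((hcont i).norm.continuousOn).div ((hcont d).norm.continuousOn)
      fun t ht => norm_ne_zero_iff.2 (hlead t ht)
  obtain ⟨R, hR⟩ := isCompact_Icc.exists_bound_of_continuousOn hb
  refine ⟨R, fun t ht z hz => ?_⟩
  have hnd : (N t).natDegree = d := le_antisymm (hdeg t) (le_natDegree_of_ne_zero (hlead t ht))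
  have h0 : N t ≠ 0 := by
    intro h
    exact hlead t ht (by simp [h])
  refine le_trans ?_ ((le_abs_self _).trans (hR t ht))
  refine (NNReal.coe_le_coe.2 (hz.norm_lt_cauchyBound h0).le).trans ?_
  have hl : (N t).leadingCoeff = (N t).coeff d := by rw [leadingCoeff, hnd]
  rw [cauchyBound, hnd, hl]
  push_cast
  rw [← Finset.sum_div]
  gcongr
  have : (Finset.range d).sup (fun i => ‖(N t).coeff i‖₊) ≤
      ∑ i ∈ Finset.range d, ‖(N t).coeff i‖₊ :=
    Finset.sup_le fun i hi =>
      Finset.single_le_sum (f := fun i => ‖(N t).coeff i‖₊) (fun _ _ => zero_le) hi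
  simpa using NNReal.coe_le_coe.2 this

/-- If a polynomial varies continuously, keeps its degree and never has a root on the imaginary
axis, then no root crosses from one open half-plane to the other. -/
theorem rhpRootCount_eq_of_homotopy {d : ℕ} {N : ℝ → ℂ[X]}
    (hcont : ∀ i, Continuous fun t => (N t).coeff i)
    (hdeg : ∀ t, (N t).natDegree ≤ d) (hlead : ∀ t ∈ Set.Icc (0 : ℝ) 1, (N t).coeff d ≠ 0)
    (haxis : ∀ t ∈ Set.Icc (0 : ℝ) 1, ∀ z : ℂ, z.re = 0 → (N t).eval z ≠ 0) :
    rhpRootCount (N 0) = rhpRootCount (N 1) := by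
  obtain ⟨R, hR⟩ := exists_root_bound hcont hdeg hlead
  have heval : ∀ z, Continuous fun t => (N t).eval z := by
    intro z
    have h : ∀ t, (N t).eval z = ∑ i ∈ Finset.range (d + 1), (N t).coeff i * z ^ i := fun t =>
      eval_eq_sum_range' (Nat.lt_succ_of_le (hdeg t)) z
    simp only [h]
    fun_prop
  -- `S A` consists of the parameters with an enumeration of the roots whose members in the
  -- right half-plane are those with index in `A`. Weak inequalities make it closed; they are
  -- strict because no root lies on the imaginary axis.
  let S : Finset (Fin d) → Set (ℝ × (Fin d → ℂ)) := fun A =>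
    {x | x.1 ∈ Set.Icc (0 : ℝ) 1} ∩ {x | ∀ i, x.2 i ∈ Metric.closedBall (0 : ℂ) R} ∩
      {x | ∀ z, (N x.1).eval z = (N x.1).coeff d * ∏ i, (z - x.2 i)} ∩
      ({x | ∀ i ∈ A, 0 ≤ (x.2 i).re} ∩ {x | ∀ i ∉ A, (x.2 i).re ≤ 0})
  have hSclosed : ∀ A, IsClosed (S A) := by
    intro A
    refine ((isClosed_Icc.preimage continuous_fst).inter ?_ |>.inter ?_).inter (.inter ?_ ?_)
    · simp only [Set.ofPred_forall]
      exact isClosed_iInter fun i => Metric.isClosed_closedBall.preimage (by fun_prop)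
    · simp only [Set.ofPred_forall]
      refine isClosed_iInter fun z => isClosed_eq ((heval z).comp continuous_fst) ?_
      exact ((hcont d).comp continuous_fst).mul (by fun_prop)
    · simp only [Set.ofPred_forall]
      exact isClosed_iInter fun i => isClosed_iInter fun _ =>
        isClosed_le continuous_const (Complex.continuous_re.comp (by fun_prop))
    · simp only [Set.ofPred_forall]
      exact isClosed_iInter fun i => isClosed_iInter fun _ =>
        isClosed_le (Complex.continuous_re.comp (by fun_prop)) continuous_const
  have hScompact : ∀ A, IsCompact (S A) := fun A =>
    (isCompact_Icc.prod
      (isCompact_univ_pi fun _ => isCompact_closedBall (0 : ℂ) R)).of_isClosed_subset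
      (hSclosed A) fun x hx => ⟨hx.1.1.1, fun i _ => hx.1.1.2 i⟩
  have hTclosed : ∀ A, IsClosed (Prod.fst '' S A) := fun A =>
    ((hScompact A).image continuous_fst).isClosed
  have hcount : ∀ A, ∀ t ∈ Prod.fst '' S A, rhpRootCount (N t) = A.card := by
    rintro A _ ⟨⟨t, r⟩, ⟨⟨⟨ht, -⟩, hr⟩, hA, hA'⟩, rfl⟩
    have hN : N t = C ((N t).coeff d) * ∏ i, (X - C (r i)) :=
      Polynomial.funext fun z => by simpa [eval_prod] using hr z
    have hre : ∀ i, (r i).re ≠ 0 := fun i h0 =>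
      haxis t ht (r i) h0 (by rw [hr (r i)]; simp [Finset.prod_eq_zero (Finset.mem_univ i)])
    rw [hN, rhpRootCount_prod (hlead t ht)]
    congr 1
    ext i
    simp only [Finset.mem_filter, Finset.mem_univ, true_and]
    constructor
    · intro h
      by_contra hi
      exact absurd (hA' i hi) (not_le.2 h)
    · intro hi
      exact lt_of_le_of_ne (hA i hi) (hre i).symm
  have hcover : ∀ t ∈ Set.Icc (0 : ℝ) 1, ∃ A, t ∈ Prod.fst '' S A := by
    intro t ht
    have hnd : (N t).natDegree = d := le_antisymm (hdeg t) (le_natDegree_of_ne_zero (hlead t ht))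
    obtain ⟨r, hr⟩ := exists_tuple_of_card_eq (N t).roots
      (((IsAlgClosed.splits (N t)).natDegree_eq_card_roots).symm.trans hnd)
    have hN : N t = C ((N t).coeff d) * ∏ i, (X - C (r i)) := by
      conv_lhs => rw [(IsAlgClosed.splits (N t)).eq_prod_roots, ← hr, Multiset.map_map]
      rw [leadingCoeff, hnd]
      rfl
    refine ⟨Finset.univ.filter fun i => 0 < (r i).re, (t, r), ⟨⟨⟨ht, fun i => ?_⟩, fun z => ?_⟩,
      fun i hi => (Finset.mem_filter.1 hi).2.le, fun i hi => ?_⟩, rfl⟩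
    · rw [mem_closedBall_zero_iff]
      refine hR t ht _ ?_
      change (N t).IsRoot (r i)
      rw [hN, IsRoot.def, eval_mul, eval_prod]
      simp [Finset.prod_eq_zero (Finset.mem_univ i)]
    · change (N t).eval z = _
      conv_lhs => rw [hN]
      simp [eval_prod]
    · simpa using hi
  by_contra hne
  have hclosed : ∀ p : Finset (Fin d) → Prop, IsClosed (⋃ A ∈ {A | p A}, Prod.fst '' S A) :=
    fun p => (Set.toFinite _).isClosed_biUnion fun A _ => hTclosed A
  have hconn := isPreconnected_closed_iff.1 (isPreconnected_Icc (a := (0 : ℝ)) (b := 1)) _ _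
    (hclosed fun A => A.card = rhpRootCount (N 0)) (hclosed fun A => A.card ≠ rhpRootCount (N 0))
    (fun t ht => ?_) ?_ ?_
  · obtain ⟨t, -, h1, h2⟩ := hconn
    simp only [Set.mem_iUnion] at h1 h2
    obtain ⟨A, hA, h1⟩ := h1
    obtain ⟨B, hB, h2⟩ := h2
    exact hB (((hcount B t h2).symm.trans (hcount A t h1)).trans hA)
  · obtain ⟨A, hA⟩ := hcover t ht
    by_cases h : A.card = rhpRootCount (N 0)
    · exact Or.inl (Set.mem_biUnion (show A ∈ {A | _} from h) hA)
    · exact Or.inr (Set.mem_biUnion (show A ∈ {A | _} from h) hA)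
  · have h0 : (0 : ℝ) ∈ Set.Icc (0 : ℝ) 1 := by simp
    obtain ⟨A, hA⟩ := hcover 0 h0
    exact ⟨0, h0, Set.mem_biUnion (show A ∈ {A | _} from (hcount A 0 hA).symm) hA⟩
  · have h1 : (1 : ℝ) ∈ Set.Icc (0 : ℝ) 1 := by simp
    obtain ⟨A, hA⟩ := hcover 1 h1
    exact ⟨1, h1, Set.mem_biUnion
      (show A ∈ {A | _} from fun h => hne (h.symm.trans (hcount A 1 hA).symm)) hA⟩

end RootCount

/-! ### Gain, phase and passivity conditions at one frequency -/

section Frequency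

variable {n : Type*} [Fintype n] [DecidableEq n]

/-- The first singular value bounds the operator norm, by the spectral theorem for `T† T`. -/
theorem norm_apply_le_singularValue {E F : Type*} [NormedAddCommGroup E] [InnerProductSpace ℂ E]
    [FiniteDimensional ℂ E] [NormedAddCommGroup F] [InnerProductSpace ℂ F]
    [FiniteDimensional ℂ F] (T : E →ₗ[ℂ] F) (x : E) : ‖T x‖ ≤ T.singularValues 0 * ‖x‖ := by
  have hs := T.isSymmetric_adjoint_comp_self
  let b := hs.eigenvectorBasis rfl
  have h1 : ‖T x‖ ^ 2 = ∑ i, hs.eigenvalues rfl i * ‖b.repr x i‖ ^ 2 := by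
    have h2 : ((‖T x‖ ^ 2 : ℝ) : ℂ) = inner ℂ x ((LinearMap.adjoint T ∘ₗ T) x) := by
      rw [LinearMap.comp_apply, LinearMap.adjoint_inner_right, inner_self_eq_norm_sq_to_K]
      simp
    rw [← b.sum_inner_mul_inner] at h2
    apply Complex.ofReal_injective
    rw [h2]
    push_cast
    refine Finset.sum_congr rfl fun i _ => ?_
    have h3 : b.repr ((LinearMap.adjoint T) (T x)) i = hs.eigenvalues rfl i * b.repr x i :=
      hs.eigenvectorBasis_apply_self_apply rfl x i
    rw [← b.repr_apply_apply, Function.comp_apply, h3, ← inner_conj_symm, ← b.repr_apply_apply,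
      ← Complex.conj_mul']
    ring
  have h3 : ‖x‖ ^ 2 = ∑ i, ‖b.repr x i‖ ^ 2 := by
    rw [← b.repr.norm_map x, EuclideanSpace.norm_sq_eq]
  refine le_of_sq_le_sq ?_ (mul_nonneg (T.singularValues_nonneg 0) (norm_nonneg x))
  rw [mul_pow, h1, h3, Finset.mul_sum]
  refine Finset.sum_le_sum fun i _ => ?_
  gcongr
  rw [← T.sq_singularValues_fin rfl i]
  exact pow_le_pow_left₀ (T.singularValues_nonneg _) (T.singularValues_antitone (Nat.zero_le _)) 2

theorem phase_le_maxPhase (A : Matrix n n ℂ) {x : EuclideanSpace ℂ n} (hx : x ≠ 0)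
    (hAx : Matrix.toEuclideanLin A x ≠ 0) :
    phase x (Matrix.toEuclideanLin A x) ≤ maxPhase A := by
  set y := Matrix.toEuclideanLin A x with hy
  refine le_csSup ⟨Real.pi, ?_⟩ ⟨gain x y * Complex.exp (phase x y * Complex.I),
    ⟨x, hx, hAx, Or.inl rfl⟩, ?_⟩
  · rintro _ ⟨z, -, rfl⟩
    exact Complex.abs_arg_le_pi z
  · have hg : 0 < gain x y := div_pos (norm_pos_iff.2 hAx) (norm_pos_iff.2 hx)
    have h0 : 0 ≤ phase x y := Real.arccos_nonneg _
    have h1 : phase x y ≤ Real.pi := Real.arccos_le_pi _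
    change |Complex.arg _| = _
    rw [Complex.exp_mul_I, Complex.arg_mul_cos_add_sin_mul_I hg
      ⟨by linarith [Real.pi_pos], h1⟩, abs_of_nonneg h0]

theorem re_dotProduct_mulVec_add_conjTranspose (A : Matrix n n ℂ) (x : EuclideanSpace ℂ n) :
    (star x.ofLp ⬝ᵥ (A + A.conjTranspose).mulVec x.ofLp).re =
      2 * (inner ℂ x (Matrix.toEuclideanLin A x)).re := by
  have h1 : star x.ofLp ⬝ᵥ A.mulVec x.ofLp = inner ℂ x (Matrix.toEuclideanLin A x) := by
    rw [EuclideanSpace.inner_eq_star_dotProduct, dotProduct_comm]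
    rfl
  have h2 : star x.ofLp ⬝ᵥ A.conjTranspose.mulVec x.ofLp =
      star (star x.ofLp ⬝ᵥ A.mulVec x.ofLp) := by
    rw [Matrix.dotProduct_mulVec, ← Matrix.star_mulVec, Matrix.star_dotProduct]
  rw [Matrix.add_mulVec, dotProduct_add, h2, h1, Complex.add_re]
  simp only [RCLike.star_def, Complex.conj_re]
  ring

/-- Each of the small gain, small phase and passivity conditions excludes a nontrivial solution
of `x = t A B x`, for all `t ∈ [0, 1]`. -/
theorem det_one_sub_smul_ne_zero {A B : Matrix n n ℂ}
    (h : maxSingularValue A * maxSingularValue B < 1 ∨ maxPhase A + maxPhase (-B) < Real.pi ∨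
      ((A + A.conjTranspose).PosSemidef ∧ (-(B + B.conjTranspose)).PosDef))
    {t : ℝ} (ht : t ∈ Set.Icc (0 : ℝ) 1) : (1 - (t : ℂ) • (A * B)).det ≠ 0 := by
  intro hdet
  obtain ⟨x₀, hx₀, hker⟩ := Matrix.exists_mulVec_eq_zero_iff.2 hdet
  let x : EuclideanSpace ℂ n := WithLp.toLp 2 x₀
  have hx : x ≠ 0 := fun h => hx₀ (by simpa [x] using congrArg WithLp.ofLp h)
  set y := Matrix.toEuclideanLin B x with hy
  set w := Matrix.toEuclideanLin A y with hw
  have hxw : x = (t : ℂ) • w := by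
    rw [Matrix.sub_mulVec, Matrix.one_mulVec, sub_eq_zero, Matrix.smul_mulVec,
      ← Matrix.mulVec_mulVec] at hker
    exact congrArg (WithLp.toLp 2) hker
  have ht0 : 0 < t := by
    refine lt_of_le_of_ne ht.1 ?_
    rintro rfl
    exact hx (by simpa using hxw)
  have hw0 : w ≠ 0 := by
    intro h
    exact hx (by simpa [h] using hxw)
  have hy0 : y ≠ 0 := by
    intro h
    exact hw0 (by rw [hw, h, map_zero])
  -- Since `x = t w` with `t > 0`, gains and phases of `B` and `A` along `x ↦ y ↦ w` are related by
  -- the two identities that follow.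
  have hnorm : ‖x‖ = t * ‖w‖ := by
    rw [hxw, norm_smul, Complex.norm_real, Real.norm_of_nonneg ht.1]
  have hinner : (inner ℂ x y).re = t * (inner ℂ y w).re := by
    rw [← inner_conj_symm, Complex.conj_re, hxw, inner_smul_right, Complex.re_ofReal_mul]
  have hxpos := norm_pos_iff.2 hx
  have hypos := norm_pos_iff.2 hy0
  have hwpos := norm_pos_iff.2 hw0
  rcases h with h | h | ⟨hA, hB⟩
  · have h1 : ‖w‖ ≤ maxSingularValue A * ‖y‖ := norm_apply_le_singularValue _ y
    have h2 : ‖y‖ ≤ maxSingularValue B * ‖x‖ := norm_apply_le_singularValue _ x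
    have hA : 0 ≤ maxSingularValue A := LinearMap.singularValues_nonneg _ 0
    have h3 : ‖x‖ ≤ maxSingularValue A * maxSingularValue B * ‖x‖ :=
      calc ‖x‖ = t * ‖w‖ := hnorm
        _ ≤ 1 * ‖w‖ := by gcongr; exact ht.2
        _ ≤ maxSingularValue A * (maxSingularValue B * ‖x‖) := by
          rw [one_mul]; exact h1.trans (by gcongr)
        _ = _ := by ring
    nlinarith
  · have hBx : Matrix.toEuclideanLin (-B) x = -y := by rw [map_neg, LinearMap.neg_apply]
    have h1 : phase y w ≤ maxPhase A := phase_le_maxPhase A hy0 hw0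
    have h2 : phase x (-y) ≤ maxPhase (-B) := by
      rw [← hBx]
      exact phase_le_maxPhase (-B) hx (by rw [hBx]; exact neg_ne_zero.2 hy0)
    -- `x` is a positive multiple of `w`, so the angles from `y` to `w` and from `x` to `-y` are
    -- supplementary.
    have h3 : phase x (-y) = Real.pi - phase y w := by
      rw [phase, phase, inner_neg_right, norm_neg, Complex.neg_re, neg_div, Real.arccos_neg,
        hinner, hnorm]
      congr 2
      field_simp
    linarith
  · have h1 := (Complex.nonneg_iff.1 (hA.dotProduct_mulVec_nonneg y.ofLp)).1
    have h2 := (Complex.pos_iff.1 (hB.dotProduct_mulVec_pos (x := x.ofLp) hx₀)).1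
    rw [re_dotProduct_mulVec_add_conjTranspose] at h1
    rw [Matrix.neg_mulVec, dotProduct_neg, Complex.neg_re,
      re_dotProduct_mulVec_add_conjTranspose] at h2
    have h3 : 0 ≤ t * (inner ℂ y w).re := mul_nonneg ht.1 (by linarith)
    linarith

end Frequency

/-! ### The return difference as a quotient of polynomials -/

section ReturnDifference

open Polynomial

variable {n : Type*} [Fintype n] [DecidableEq n]

theorem continuous_coeff_mul {f g : ℝ → ℂ[X]} (hf : ∀ i, Continuous fun t => (f t).coeff i)
    (hg : ∀ i, Continuous fun t => (g t).coeff i) (i : ℕ) :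
    Continuous fun t => (f t * g t).coeff i := by
  simp only [coeff_mul]
  exact continuous_finsetSum _ fun x _ => (hf _).mul (hg _)

theorem continuous_coeff_prod {ι : Type*} (s : Finset ι) {f : ι → ℝ → ℂ[X]}
    (hf : ∀ k i, Continuous fun t => (f k t).coeff i) (i : ℕ) :
    Continuous fun t => (∏ k ∈ s, f k t).coeff i := by
  classical
  induction s using Finset.induction_on generalizing i with
  | empty => simpa using continuous_const
  | insert a s ha ih =>
    simp only [Finset.prod_insert ha]
    exact continuous_coeff_mul (hf a) ih i

theorem continuous_coeff_det {A : ℝ → Matrix n n ℂ[X]}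
    (hA : ∀ a b i, Continuous fun t => (A t a b).coeff i) (i : ℕ) :
    Continuous fun t => (A t).det.coeff i := by
  simp only [Matrix.det_apply, finsetSum_coeff, Units.smul_def, coeff_smul]
  exact continuous_finsetSum _ fun σ _ =>
    (continuous_coeff_prod _ (fun k => hA (σ k) k) i).const_smul _

theorem natDegree_det_le {R : Type*} [CommRing R] {A : Matrix n n R[X]} {k : ℕ}
    (hA : ∀ i j, (A i j).natDegree ≤ k) : A.det.natDegree ≤ Fintype.card n * k := by
  rw [Matrix.det_apply]
  refine natDegree_sum_le_of_forall_le _ _ fun σ _ => ?_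
  refine (natDegree_smul_le _ _).trans ((natDegree_prod_le _ _).trans ?_)
  exact (Finset.sum_le_card_nsmul _ _ k fun i _ => hA _ _).trans (by simp)

theorem coeff_det_of_natDegree_le {R : Type*} [CommRing R] {A : Matrix n n R[X]} {k : ℕ}
    (hA : ∀ i j, (A i j).natDegree ≤ k) :
    A.det.coeff (Fintype.card n * k) = (A.map fun p => p.coeff k).det := by
  rw [Matrix.det_apply, Matrix.det_apply, finsetSum_coeff]
  refine Finset.sum_congr rfl fun σ _ => ?_
  rw [Units.smul_def, Units.smul_def, coeff_smul]
  congr 1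
  exact coeff_prod_of_natDegree_le _ _ _ fun i _ => hA _ _

/-- Every rational function is a polynomial over each multiple `q` of its denominator. -/
theorem exists_numerator {q : ℝ[X]} (hq : q.Monic) {g : RatFunc ℝ} (hg : g.denom ∣ q) :
    ∃ p : ℝ[X], algebraMap ℝ[X] (RatFunc ℝ) p = algebraMap _ _ q * g ∧
      (IsProper g → p.natDegree ≤ q.natDegree ∧ p.coeff q.natDegree = valueAtInfty g) ∧
      ∀ z : ℂ, (q.map (algebraMap ℝ ℂ)).eval z ≠ 0 → (p.map (algebraMap ℝ ℂ)).eval z =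
        (q.map (algebraMap ℝ ℂ)).eval z * g.eval (algebraMap ℝ ℂ) z := by
  obtain ⟨e, rfl⟩ := hg
  have hd := RatFunc.monic_denom g
  have he : e.Monic := hd.of_mul_monic_left hq
  have hdeg : (g.denom * e).natDegree = g.denom.natDegree + e.natDegree := hd.natDegree_mul he
  refine ⟨g.num * e, ?_, fun hp => ⟨?_, ?_⟩, fun z hz => ?_⟩
  · have h0 : algebraMap ℝ[X] (RatFunc ℝ) g.denom ≠ 0 := by simpa using g.denom_ne_zero
    conv_rhs => rw [← RatFunc.num_div_denom g]
    simp only [map_mul]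
    field_simp
    simp [mul_comm]
  · rw [hdeg]
    exact natDegree_mul_le.trans (Nat.add_le_add_right hp _)
  · rw [hdeg, coeff_mul_add_eq_of_natDegree_le hp le_rfl, he.coeff_natDegree, valueAtInfty,
      hd.leadingCoeff]
    simp
  · rw [Polynomial.map_mul, eval_mul] at hz
    have h0 := left_ne_zero_of_mul hz
    rw [RatFunc.eval, Polynomial.map_mul, Polynomial.map_mul, eval_mul, eval_mul,
      ← eval_map, ← eval_map]
    field_simp

theorem exists_common_denominator {l : Type*} [Fintype l] {G : Matrix l l (RatFunc ℝ)}
    (hG : RLinf G) :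
    ∃ q : ℝ[X], q.Monic ∧ (∀ i j, (G i j).denom ∣ q) ∧
      ∀ ω : ℝ, (q.map (algebraMap ℝ ℂ)).eval (ω * Complex.I) ≠ 0 := by
  refine ⟨∏ i, ∏ j, (G i j).denom,
    monic_prod_of_monic _ _ fun i _ => monic_prod_of_monic _ _ fun j _ => RatFunc.monic_denom _,
    fun i j => (Finset.dvd_prod_of_mem (fun j => (G i j).denom) (Finset.mem_univ j)).trans
      (Finset.dvd_prod_of_mem (fun i => ∏ j, (G i j).denom) (Finset.mem_univ i)), fun ω => ?_⟩
  rw [Polynomial.map_prod, eval_prod]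
  refine Finset.prod_ne_zero_iff.2 fun i _ => ?_
  rw [Polynomial.map_prod, eval_prod]
  exact Finset.prod_ne_zero_iff.2 fun j _ => hG.2 i j ω

theorem finsum_rootMult (p : ℝ[X]) :
    ∑ᶠ s ∈ openRHP, rootMult s p = rhpRootCount (p.map (algebraMap ℝ ℂ)) := by
  classical
  set r := (p.map (algebraMap ℝ ℂ)).roots
  have hcount : ∀ s, rootMult s p = r.count s := fun s => (count_roots _).symm
  rw [rhpRootCount, Multiset.countP_eq_card_filter, ← Multiset.toFinset_sum_count_eq,
    finsum_mem_eq_sum_of_inter_support_eq (t := (r.filter fun z => 0 < z.re).toFinset)]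
  · refine Finset.sum_congr rfl fun s hs => ?_
    have hs' : 0 < s.re := (Multiset.mem_filter.1 (Multiset.mem_toFinset.1 hs)).2
    rw [hcount, Multiset.count_filter_of_pos (p := fun z : ℂ => 0 < z.re) hs']
  · ext s
    simp only [Set.mem_inter_iff, Function.mem_support, hcount, ne_eq, Multiset.count_eq_zero,
      not_not, Finset.mem_coe, Multiset.mem_toFinset, Multiset.mem_filter, openRHP]
    constructor
    · rintro ⟨h1, h2⟩
      exact ⟨⟨h2, h1⟩, h2⟩
    · rintro ⟨⟨h1, h2⟩, -⟩
      exact ⟨h2, h1⟩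

theorem finite_support_rootMult {p : ℝ[X]} (hp : p ≠ 0) :
    (Function.support fun s => rootMult s p).Finite := by
  refine (finite_setOfPred_isRoot (map_complex_ne_zero hp)).subset fun s hs => ?_
  exact (rootMultiplicity_pos'.1 (Nat.pos_of_ne_zero hs)).2

/-- The frequency-domain content of the hypotheses: the return difference `det (I - P C)` is a
quotient `L / D` of two polynomials of equal degree, without roots on the imaginary axis and with
equally many roots in the right half-plane. The homotopy `det (I - t P C)`, `t ∈ [0, 1]`, joins
the two counts. -/
theorem exists_return_difference_quotient {P C : Matrix n n (RatFunc ℝ)} (hP : RLinf P)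
    (hC : RLinf C)
    (hdet : ∀ ω : EReal, ∀ t ∈ Set.Icc (0 : ℝ) 1,
      (1 - (t : ℂ) • (freqResp P ω * freqResp C ω)).det ≠ 0) :
    ∃ D L : ℝ[X], D ≠ 0 ∧ L ≠ 0 ∧
      (1 - P * C).det * algebraMap ℝ[X] (RatFunc ℝ) D = algebraMap _ _ L ∧
      L.natDegree = D.natDegree ∧
      (∀ ω : ℝ, rootMult (ω * Complex.I) D = 0 ∧ rootMult (ω * Complex.I) L = 0) ∧
      rhpRootCount (D.map (algebraMap ℝ ℂ)) = rhpRootCount (L.map (algebraMap ℝ ℂ)) := by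
  obtain ⟨q₁, hq₁, hd₁, ha₁⟩ := exists_common_denominator hP
  obtain ⟨q₂, hq₂, hd₂, ha₂⟩ := exists_common_denominator hC
  set q := q₁ * q₂ with hqdef
  have hq : q.Monic := hq₁.mul hq₂
  have haxis : ∀ ω : ℝ, (q.map (algebraMap ℝ ℂ)).eval (ω * Complex.I) ≠ 0 := by
    intro ω
    rw [hqdef, Polynomial.map_mul, eval_mul]
    exact mul_ne_zero (ha₁ ω) (ha₂ ω)
  choose A hA hA' hA'' using fun i j => exists_numerator hq ((hd₁ i j).mul_right q₂)
  choose B hB hB' hB'' using fun i j => exists_numerator hq ((hd₂ i j).mul_left q₁)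
  set d := q.natDegree with hd
  let φ : ℝ[X] →+* ℂ[X] := mapRingHom (algebraMap ℝ ℂ)
  let E : ℝ → Matrix n n ℂ[X] := fun t => Matrix.of fun i j =>
    φ q ^ 2 * (1 : Matrix n n ℂ[X]) i j - Polynomial.C (t : ℂ) * ∑ k, φ (A i k) * φ (B k j)
  let N : ℝ → ℂ[X] := fun t => (E t).det
  have hφq : (φ q).natDegree = d := natDegree_map _
  have hφm : (φ q).Monic := hq.map _
  have hdA : ∀ i j, (φ (A i j)).natDegree ≤ d := fun i j =>
    natDegree_map_le.trans (hA' i j (hP.1 i j)).1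
  have hdB : ∀ i j, (φ (B i j)).natDegree ≤ d := fun i j =>
    natDegree_map_le.trans (hB' i j (hC.1 i j)).1
  have hdsum : ∀ i j, (∑ k, φ (A i k) * φ (B k j)).natDegree ≤ d + d := fun i j =>
    natDegree_sum_le_of_forall_le _ _ fun k _ =>
      natDegree_mul_le.trans (Nat.add_le_add (hdA i k) (hdB k j))
  have hdone : ∀ i j, (φ q ^ 2 * (1 : Matrix n n ℂ[X]) i j).natDegree ≤ d + d := by
    intro i j
    by_cases h : i = j
    · subst h
      rw [Matrix.one_apply_eq, mul_one, hφm.natDegree_pow, hφq, two_mul]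
    · simp [h]
  have hdE : ∀ t i j, (E t i j).natDegree ≤ d + d := fun t i j =>
    (natDegree_sub_le _ _).trans (max_le (hdone i j)
      ((natDegree_C_mul_le _ _).trans (hdsum i j)))
  -- The top coefficient of `N t` is the return difference at infinity.
  have hlead : ∀ t : ℝ, (N t).coeff (Fintype.card n * (d + d)) =
      (1 - (t : ℂ) • (freqResp P ⊤ * freqResp C ⊤)).det := by
    intro t
    rw [coeff_det_of_natDegree_le (hdE t)]
    congr 1
    ext i j
    have h1 : (φ q ^ 2 * (1 : Matrix n n ℂ[X]) i j).coeff (d + d) = (1 : Matrix n n ℂ) i j := by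
      have h2 : (φ q ^ 2).coeff (d + d) = 1 := by
        rw [← two_mul, ← hφq, ← hφm.natDegree_pow, (hφm.pow 2).coeff_natDegree]
      by_cases h : i = j <;> simp [Matrix.one_apply, h, h2]
    have h3 : (∑ k, φ (A i k) * φ (B k j)).coeff (d + d) =
        (freqResp P ⊤ * freqResp C ⊤) i j := by
      rw [finsetSum_coeff, Matrix.mul_apply]
      refine Finset.sum_congr rfl fun k _ => ?_
      rw [coeff_mul_add_eq_of_natDegree_le (hdA i k) (hdB k j)]
      simp [φ, freqResp, (hA' i k (hP.1 i k)).2, (hB' k j (hC.1 k j)).2]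
    simp only [Matrix.map_apply, E, Matrix.of_apply, coeff_sub, coeff_C_mul, h1, h3,
      Matrix.sub_apply, Matrix.smul_apply, smul_eq_mul]
  have heval : ∀ (t ω : ℝ), (N t).eval (ω * Complex.I) =
      ((φ q).eval (ω * Complex.I) ^ 2) ^ Fintype.card n *
        (1 - (t : ℂ) • (freqResp P ω * freqResp C ω)).det := by
    intro t ω
    rw [← Matrix.det_smul, ← coe_evalRingHom, RingHom.map_det]
    congr 1
    ext i j
    have hA2 := fun k => hA'' i k _ (haxis ω)
    have hB2 := fun k => hB'' k j _ (haxis ω)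
    have h1 : ((1 : Matrix n n ℂ[X]) i j).eval (ω * Complex.I) = (1 : Matrix n n ℂ) i j := by
      by_cases h : i = j <;> simp [Matrix.one_apply, h]
    simp only [RingHom.mapMatrix_apply, Matrix.map_apply, E, Matrix.of_apply, coe_evalRingHom,
      eval_sub, eval_mul, eval_pow, eval_C, eval_finsetSum, h1, Matrix.smul_apply,
      Matrix.sub_apply, Matrix.mul_apply, smul_eq_mul, φ, coe_mapRingHom, hA2, hB2, freqResp,
      EReal.coe_ne_top, EReal.coe_ne_bot, or_self, if_false, EReal.toReal_coe, Finset.mul_sum,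
      mul_sub]
    congr 1
    refine Finset.sum_congr rfl fun k _ => ?_
    ring
  have hcoeff : ∀ i, Continuous fun t => (N t).coeff i := by
    refine continuous_coeff_det fun a b i => ?_
    simp only [E, Matrix.of_apply, coeff_sub, coeff_C_mul]
    fun_prop
  have hmem : (1 : ℝ) ∈ Set.Icc (0 : ℝ) 1 := by simp
  have hhom := rhpRootCount_eq_of_homotopy hcoeff (fun t => natDegree_det_le (hdE t))
    (fun t ht => by rw [hlead]; exact hdet ⊤ t ht) (fun t ht z hz => by
      have hz' : z = (z.im : ℝ) * Complex.I := by apply Complex.ext <;> simp [hz]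
      rw [hz', heval]
      exact mul_ne_zero (pow_ne_zero _ (pow_ne_zero _ (haxis _))) (hdet _ t ht))
  let F : Matrix n n ℝ[X] := Matrix.of fun i j =>
    q ^ 2 * (1 : Matrix n n ℝ[X]) i j - ∑ k, A i k * B k j
  have hN1 : F.det.map (algebraMap ℝ ℂ) = N 1 := by
    rw [← coe_mapRingHom, RingHom.map_det]
    congr 1
    ext1 i j
    have h1 : φ ((1 : Matrix n n ℝ[X]) i j) = (1 : Matrix n n ℂ[X]) i j := by
      by_cases h : i = j <;> simp [Matrix.one_apply, h]
    have h2 : φ (F i j) = E 1 i j := by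
      simp only [F, E, Matrix.of_apply, map_sub, map_mul, map_pow, map_sum, h1]
      simp
    exact h2
  have hN0 : ((q ^ 2) ^ Fintype.card n).map (algebraMap ℝ ℂ) = N 0 := by
    have h1 : E 0 = (φ q ^ 2) • (1 : Matrix n n ℂ[X]) := by
      ext1 i j
      simp [E]
    change _ = (E 0).det
    rw [h1, Matrix.det_smul, Matrix.det_one, mul_one]
    simp [φ]
  have hD0 : (q ^ 2) ^ Fintype.card n ≠ 0 := pow_ne_zero _ (pow_ne_zero _ hq.ne_zero)
  have hN1c : (N 1).coeff (Fintype.card n * (d + d)) ≠ 0 := by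
    rw [hlead]
    exact hdet ⊤ 1 hmem
  have hL0 : F.det ≠ 0 := by
    intro h
    rw [h, Polynomial.map_zero] at hN1
    exact hN1c (by rw [← hN1, coeff_zero])
  refine ⟨(q ^ 2) ^ Fintype.card n, F.det, hD0, hL0, ?_, ?_, fun ω => ⟨?_, ?_⟩, ?_⟩
  · rw [map_pow, mul_comm, ← Matrix.det_smul, RingHom.map_det]
    congr 1
    ext1 i j
    have h1 : algebraMap ℝ[X] (RatFunc ℝ) ((1 : Matrix n n ℝ[X]) i j) =
        (1 : Matrix n n (RatFunc ℝ)) i j := by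
      by_cases h : i = j <;> simp [Matrix.one_apply, h]
    simp only [RingHom.mapMatrix_apply, Matrix.map_apply, F, Matrix.of_apply, map_sub, map_mul,
      map_pow, map_sum, h1, hA, hB, Matrix.smul_apply, Matrix.sub_apply, Matrix.mul_apply,
      smul_eq_mul, mul_sub, Finset.mul_sum]
    congr 1
    refine Finset.sum_congr rfl fun k _ => ?_
    ring
  · have h1 : F.det.natDegree = Fintype.card n * (d + d) := by
      rw [← natDegree_map (algebraMap ℝ ℂ), hN1]
      exact le_antisymm (natDegree_det_le (hdE 1)) (le_natDegree_of_ne_zero hN1c)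
    rw [h1, (hq.pow 2).natDegree_pow, hq.natDegree_pow, two_mul]
  · refine rootMultiplicity_eq_zero ?_
    rw [IsRoot.def, Polynomial.map_pow, Polynomial.map_pow, eval_pow, eval_pow]
    exact pow_ne_zero _ (pow_ne_zero _ (haxis ω))
  · refine rootMultiplicity_eq_zero ?_
    rw [IsRoot.def, hN1, heval]
    exact mul_ne_zero (pow_ne_zero _ (pow_ne_zero _ (haxis ω))) (hdet _ 1 hmem)
  · rw [hN0, hN1]
    exact hhom

end ReturnDifference

/-! ### The closed loop -/

section ClosedLoop

open scoped WithZero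

variable {n : Type*} [Fintype n] [DecidableEq n]

open Classical in
theorem isProper_iff_inftyValuation (g : RatFunc ℝ) :
    IsProper g ↔ RatFunc.inftyValuation ℝ g ≤ 1 := by
  by_cases hg : g = 0
  · simp [hg, IsProper]
  · rw [RatFunc.inftyValuation_apply, RatFunc.inftyValuation_of_nonzero _ hg, ← WithZero.exp_zero,
      WithZero.exp_le_exp, RatFunc.intDegree, IsProper]
    omega

theorem det_loop (P C : Matrix n n (RatFunc ℝ)) :
    (Matrix.fromBlocks 1 (-C) (-P) 1).det = (1 - P * C).det := by
  rw [Matrix.det_fromBlocks_one₁₁]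
  simp

/-- The closed loop is integral at every place where `P` and `C` are and where the return difference
is a unit. -/
theorem valuation_closedLoop_le_one (v : Valuation (RatFunc ℝ) ℤᵐ⁰) {P C : Matrix n n (RatFunc ℝ)}
    (hP : ∀ i j, v (P i j) ≤ 1) (hC : ∀ i j, v (C i j) ≤ 1) (hdet : v (1 - P * C).det = 1)
    (i j : n ⊕ n) : v (closedLoop P C i j) ≤ 1 := by
  refine valuation_inv_apply_le_one v ?_ (by rw [det_loop, hdet]) i j
  rintro (i | i) (j | j)
  · exact valuation_one_apply_le v i j
  · simpa using hC i j
  · simpa using hP i j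
  · exact valuation_one_apply_le v i j

/-- The return difference `det (I - P C) = L / D` accounts for the difference between open-loop and
closed-loop poles. -/
theorem poleMult_closedLoop {P C : Matrix n n (RatFunc ℝ)} {D L : Polynomial ℝ} (hD : D ≠ 0)
    (hL : L ≠ 0)
    (h : (1 - P * C).det * algebraMap (Polynomial ℝ) (RatFunc ℝ) D = algebraMap _ _ L) (s : ℂ) :
    poleMult (closedLoop P C) s + rootMult s D = poleMult P s + poleMult C s + rootMult s L := by
  have hv := congrArg (placeAt s) h
  rw [map_mul, placeAt_algebraMap s hD, placeAt_algebraMap s hL] at hv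
  have hne : (1 - P * C).det ≠ 0 := by
    intro h0
    rw [h0, zero_mul] at h
    exact hL (by simpa using h.symm)
  have key := poleVal_loop_inv_mul (placeAt s) P C (by rwa [det_loop])
  rw [det_loop] at key
  have key2 := congrArg (· * WithZero.exp (-(rootMult s D : ℤ))) key
  simp only [mul_assoc, hv] at key2
  change poleVal (placeAt s) (closedLoop P C) * _ = _ at key2
  rw [← exp_poleMult, ← exp_poleMult, ← exp_poleMult, ← WithZero.exp_add, ← WithZero.exp_add,
    ← WithZero.exp_add, WithZero.exp_inj] at key2
  omega

/-- Dominance from the return difference alone: it suffices that `I - t P C` stays invertible on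
the extended imaginary axis for all `t ∈ [0, 1]`. -/
theorem feedbackDominant_of_det_ne_zero {p₁ p₂ : ℕ} {P C : Matrix n n (RatFunc ℝ)}
    (hP : IsDominant p₁ P) (hC : IsDominant p₂ C)
    (hdet : ∀ ω : EReal, ∀ t ∈ Set.Icc (0 : ℝ) 1,
      (1 - (t : ℂ) • (freqResp P ω * freqResp C ω)).det ≠ 0) :
    FeedbackDominant (p₁ + p₂) P C := by
  classical
  obtain ⟨D, L, hD, hL, hDL, hdeg, haxis, hcount⟩ :=
    exists_return_difference_quotient hP.1 hC.1 hdet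
  refine ⟨?_, ⟨?_, ?_⟩, ?_⟩
  · refine Matrix.rank_of_isUnit _ ((Matrix.isUnit_iff_isUnit_det _).2 (isUnit_iff_ne_zero.2 ?_))
    intro h0
    refine hdet ⊤ 1 (by simp) ?_
    have h1 : (1 - ((1 : ℝ) : ℂ) • (freqResp P ⊤ * freqResp C ⊤)) =
        (algebraMap ℝ ℂ).mapMatrix (1 - P.map valueAtInfty * C.map valueAtInfty) := by
      rw [map_sub, map_mul, map_one, Complex.ofReal_one, one_smul]
      simp only [freqResp, true_or, if_true]
      rfl
    rw [h1, ← RingHom.map_det, h0, map_zero]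
  · intro i j
    rw [isProper_iff_inftyValuation]
    refine valuation_closedLoop_le_one _ (fun i j => (isProper_iff_inftyValuation _).1 (hP.1.1 i j))
      (fun i j => (isProper_iff_inftyValuation _).1 (hC.1.1 i j)) ?_ i j
    have h := congrArg (RatFunc.inftyValuation ℝ) hDL
    rw [map_mul, RatFunc.inftyValuation_apply ℝ (x := algebraMap _ _ D),
      RatFunc.inftyValuation_apply ℝ (x := algebraMap _ _ L),
      RatFunc.inftyValuation.polynomial ℝ hD, RatFunc.inftyValuation.polynomial ℝ hL, hdeg] at h
    exact mul_eq_right₀ WithZero.exp_ne_zero |>.1 h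
  · intro i j ω
    rw [← placeAt_le_one_iff]
    refine valuation_closedLoop_le_one _ (fun i j => (placeAt_le_one_iff _ _).2 (hP.1.2 i j ω))
      (fun i j => (placeAt_le_one_iff _ _).2 (hC.1.2 i j ω)) ?_ i j
    have h := congrArg (placeAt (ω * Complex.I)) hDL
    rw [map_mul, placeAt_algebraMap _ hD, placeAt_algebraMap _ hL, (haxis ω).1, (haxis ω).2] at h
    simpa using h
  · have hfin : ∀ {f : ℂ → ℕ}, (Function.support f).Finite →
        (openRHP ∩ Function.support f).Finite :=
      fun h => h.inter_of_right _
    have hsum : ∑ᶠ s ∈ openRHP, (poleMult (closedLoop P C) s + rootMult s D) =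
        ∑ᶠ s ∈ openRHP, (poleMult P s + poleMult C s + rootMult s L) :=
      finsum_mem_congr rfl fun s _ => poleMult_closedLoop hD hL hDL s
    have hPC : (Function.support fun s => poleMult P s + poleMult C s).Finite :=
      ((finite_support_poleMult P).union (finite_support_poleMult C)).subset
        (Function.support_add _ _)
    rw [finsum_mem_add_distrib' (hfin (finite_support_poleMult _))
        (hfin (finite_support_rootMult hD)),
      finsum_mem_add_distrib' (hfin hPC) (hfin (finite_support_rootMult hL)),
      finsum_mem_add_distrib' (hfin (finite_support_poleMult _)) (hfin (finite_support_poleMult _)),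
      finsum_rootMult D, finsum_rootMult L, hcount] at hsum
    have h1 : ∑ᶠ s ∈ openRHP, poleMult P s = p₁ := hP.2
    have h2 : ∑ᶠ s ∈ openRHP, poleMult C s = p₂ := hC.2
    rw [h1, h2] at hsum
    exact Nat.add_right_cancel hsum

end ClosedLoop

end Dominance

end

theorem mainTheorem4 (m p₁ p₂ : ℕ) (P C : Matrix (Fin m) (Fin m) (RatFunc ℝ))
    (hP : Dominance.IsDominant p₁ P) (hC : Dominance.IsDominant p₂ C)
    (hPC : Dominance.NoUnstableCancellation P C)
    (hfreq : ∀ ω : EReal,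
      Dominance.maxSingularValue (Dominance.freqResp P ω) *
          Dominance.maxSingularValue (Dominance.freqResp C ω) < 1 ∨
      Dominance.maxPhase (Dominance.freqResp P ω) +
          Dominance.maxPhase (-(Dominance.freqResp C ω)) < Real.pi ∨
      ((Dominance.freqResp P ω + (Dominance.freqResp P ω).conjTranspose).PosSemidef ∧
        (-(Dominance.freqResp C ω + (Dominance.freqResp C ω).conjTranspose)).PosDef)) :
    Dominance.FeedbackDominant (p₁ + p₂) P C :=
  Dominance.feedbackDominant_of_det_ne_zero hP hC fun ω _ ht =>
    Dominance.det_one_sub_smul_ne_zero (hfreq ω) ht
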